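/- Let $\mathbb{D}=\{z\in\mathbb{C}:|z|<1\}$, $\overline{\mathbb{D}}=\{z\in\mathbb{C}:|z|\le 1\}$ and $\mathbb{S}=\{z\in\mathbb{C}:|z|=1\}$. For every homeomorphism $\varphi\colon\mathbb{S}\to\mathbb{S}$ of $\mathbb{S}$ onto itself there is a homeomorphism $h\colon\overline{\mathbb{D}}\to\overline{\mathbb{D}}$ of $\overline{\mathbb{D}}$ onto itself such that $h=\varphi$ on $\mathbb{S}$ and such that, for every real $p\in[1,2)$, both $h$ and $h^{-1}$ (restricted to $\mathbb{D}$) belong to the Sobolev space $W^{1,p}(\mathbb{D},\mathbb{C})$; that is, they lie in $L^p(\mathbb{D})$ and have a weak differential that lies in $L^p(\mathbb{D})$. The same $h$ works for all $p\in[1,2)$. -/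

import Mathlib

open MeasureTheory Set
open scoped ENNReal ContDiff

noncomputable section

/-- `G` is a weak (distributional) differential of `f` on the open set `U`: both are locally
integrable on `U`, and integration by parts holds against every smooth real-valued test function
with compact support in `U`, in every direction `v`. -/
def IsWeakFDerivOn (U : Set ℂ) (f : ℂ → ℂ) (G : ℂ → ℂ →L[ℝ] ℂ) : Prop :=
  LocallyIntegrableOn f U volume ∧ LocallyIntegrableOn G U volume ∧
    ∀ η : ℂ → ℝ, ContDiff ℝ ∞ η → HasCompactSupport η → tsupport η ⊆ U →
      ∀ v : ℂ, ∫ z in U, (fderiv ℝ η z v) • f z = -∫ z in U, η z • G z v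

/-- The Sobolev class `W^{1,p}(U, ℂ)` of an open set `U` of the plane: `f` lies in `L^p(U)` and
has a weak differential on `U` that lies in `L^p(U)`. Only the values of `f` on `U` matter. -/
def MemSobolevOne (U : Set ℂ) (p : ℝ≥0∞) (f : ℂ → ℂ) : Prop :=
  MemLp f p (volume.restrict U) ∧
    ∃ G : ℂ → ℂ →L[ℝ] ℂ, IsWeakFDerivOn U f G ∧ MemLp G p (volume.restrict U)

/-- The open unit disk of the complex plane. -/
abbrev openDisk : Set ℂ := Metric.ball (0 : ℂ) 1

/-- The closed unit disk of the complex plane. -/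
abbrev closedDisk : Set ℂ := Metric.closedBall (0 : ℂ) 1

/-- A self-map of the closed unit disk, read as a complex-valued function on the plane (with the
value `0` outside the closed disk). -/
def diskMap (h : closedDisk → closedDisk) : ℂ → ℂ :=
  Function.extend Subtype.val (fun z => (h z : ℂ)) 0

theorem diskMap_coe (h : closedDisk → closedDisk) (z : closedDisk) :
    diskMap h (z : ℂ) = h z :=
  Subtype.val_injective.extend_apply _ _ z

end

/-! Lift the circle homeomorphism to a map `f` of the line with `f (x + 2π) = f x + 2πε`, `ε = ±1`,
and join `f` to `ε • id` by shearing its graph: at height `y` the point `(x, f x)` goes to `((x + yε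
f x)/(1 + y), (f x + yε x)/(1 + y))`. Since `ε f` increases, the image is again a graph, of a map
`F(·, y)` that is `1/y`-Lipschitz for `0 < y ≤ 1`. The shear treats both coordinates alike, so the
inverse lift yields the inverse isotopy. Hence `h(r e^{iw}) = r e^{iF(w, 1 - r)}` is a homeomorphism
extending the circle map, and its inverse has the same form and obeys the same estimates.

As `h` preserves the modulus, its differential in polar frames is triangular with radial entry 1, so
the Jacobian `J` is the angular derivative and `|J| ≤ 1/(1 - |z|)`. Along a curve of fixed `x` both
sheared coordinates move with bounded speed, which bounds the off-diagonal entry by `C(1 + |J|)`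
(`fderiv_polar_frame`). Therefore `|Dh| ≤ (1 + C)(1 + |J|)`, and `|Dh|^p` is at most a constant
times `(1 - |z|)^(1 - p) (1 + |J|)`. The weight is radial, so a change of variables
(`lintegral_det_mul_le`) bounds the `J` term by the integral of the weight alone, which is finite
because `p < 2`. Finally `h` is Lipschitz near compact subsets of the open disk, so its almost
everywhere differential is its weak differential. -/

noncomputable section

open Filter Topology

/-! ### Lifts of circle homeomorphisms -/

/-- A continuous map of the line that covers a circle homeomorphism of degree `ε = ±1`. -/
structure IsSignedLift (ε : ℝ) (f : ℝ → ℝ) : Prop where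
  sign_mul_self : ε * ε = 1
  continuous : Continuous f
  strictMono : StrictMono fun x => ε * f x
  add_two_pi : ∀ x, f (x + 2 * Real.pi) = f x + ε * (2 * Real.pi)

theorem exists_lift_of_circle_map (φ : C(Circle, Circle)) (x u : ℝ)
    (h : Circle.exp u = φ (Circle.exp x)) :
    ∃ f : C(ℝ, ℝ), f x = u ∧ ∀ t, Circle.exp (f t) = φ (Circle.exp t) := by
  obtain ⟨F, ⟨h0, h1⟩, -⟩ := Circle.isCoveringMap_exp.existsUnique_continuousMap_lifts
    (φ.comp Circle.exp) x u h
  exact ⟨F, h0, fun t => congrFun h1 t⟩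

theorem lift_of_identity_eq_self (f : C(ℝ, ℝ)) (x : ℝ) (hx : f x = x)
    (h : ∀ t, Circle.exp (f t) = Circle.exp t) (t : ℝ) : f t = t := by
  have := (Circle.isCoveringMap_exp.existsUnique_continuousMap_lifts Circle.exp x x rfl).unique
    (y₁ := f) (y₂ := ContinuousMap.id ℝ) ⟨hx, funext h⟩ ⟨rfl, rfl⟩
  exact congrArg (fun F : C(ℝ, ℝ) => F t) this

/-- Lifts of a circle homeomorphism and of its inverse can be chosen inverse to each other. -/
theorem exists_inverse_lifts (φ : Circle ≃ₜ Circle) :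
    ∃ f g : C(ℝ, ℝ), (∀ t, g (f t) = t) ∧ (∀ t, f (g t) = t) ∧
      ∀ t, Circle.exp (f t) = φ (Circle.exp t) := by
  obtain ⟨u, hu⟩ : ∃ u, Circle.exp u = φ (Circle.exp 0) :=
    ⟨_, Circle.exp_arg _⟩
  obtain ⟨f, hf0, hf⟩ := exists_lift_of_circle_map (φ : C(Circle, Circle)) 0 u hu
  obtain ⟨g, hg0, hg⟩ := exists_lift_of_circle_map (φ.symm : C(Circle, Circle)) u 0
    (by simp [hu])
  refine ⟨f, g, lift_of_identity_eq_self (g.comp f) 0 (by simp [hf0, hg0]) fun t => ?_,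
    lift_of_identity_eq_self (f.comp g) u (by simp [hf0, hg0]) fun t => ?_, hf⟩
  · simp [hg, hf]
  · simp [hg, hf]

/-- The increment is `2πm` for an integer `m`. Strict monotonicity gives `εm > 0`. The point where
`f` has gained exactly `2πε` differs from `x` by a positive multiple of `2π`, because `φ` is
injective, so it is at least `x + 2π` and `εm ≤ 1`. -/
theorem lift_add_two_pi {φ : Circle → Circle} (hφ : Function.Injective φ) {ε : ℝ}
    (hε : ε = 1 ∨ ε = -1) {f g : ℝ → ℝ} (hfg : ∀ t, f (g t) = t)
    (hf : StrictMono fun x => ε * f x) (hexp : ∀ t, Circle.exp (f t) = φ (Circle.exp t)) (x : ℝ) :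
    f (x + 2 * Real.pi) = f x + ε * (2 * Real.pi) := by
  have hε2 : ε * ε = 1 := by rcases hε with rfl | rfl <;> norm_num
  have hpi := Real.two_pi_pos
  obtain ⟨m, hm⟩ : ∃ m : ℤ, f (x + 2 * Real.pi) = f x + m * (2 * Real.pi) := by
    rw [← Circle.exp_eq_exp, hexp, hexp, Circle.exp_add_two_pi]
  set x' := g (f x + ε * (2 * Real.pi)) with hx'
  have hfx' : f x' = f x + ε * (2 * Real.pi) := hfg _
  obtain ⟨n, hn⟩ : ∃ n : ℤ, x' = x + n * (2 * Real.pi) := by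
    rw [← Circle.exp_eq_exp]
    apply hφ
    rw [← hexp, ← hexp, hfx', Circle.exp_eq_exp]
    rcases hε with rfl | rfl
    · exact ⟨1, by simp⟩
    · exact ⟨-1, by simp⟩
  have h1 : x < x' := by
    rw [← hf.lt_iff_lt]
    simp only [hfx', mul_add, ← mul_assoc, hε2]
    linarith
  have hn1 : (1 : ℝ) ≤ n := by
    have : (0 : ℝ) < n := by
      by_contra! h
      nlinarith
    exact_mod_cast this
  have h2 : x + 2 * Real.pi ≤ x' := by nlinarith
  have h3 := hf.monotone h2
  have h4 : ε * f x < ε * f (x + 2 * Real.pi) := hf (by linarith)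
  simp only [hfx', hm, mul_add, ← mul_assoc, hε2] at h3 h4
  have h5 : ε * m = 1 := by
    have h6 : ε * m ≤ 1 := by
      by_contra! h
      nlinarith
    have h7 : 0 < ε * m := by
      by_contra! h
      nlinarith
    rcases hε with rfl | rfl
    · have : (m : ℝ) ≤ 1 := by linarith
      have h8 : (0 : ℝ) < m := by linarith
      norm_cast at this h8
      have : m = 1 := by omega
      simp [this]
    · have : (-1 : ℝ) ≤ m := by linarith
      have h8 : (m : ℝ) < 0 := by linarith
      have h9 : (-1 : ℤ) ≤ m := by exact_mod_cast this
      norm_cast at h8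
      have : m = -1 := by omega
      simp [this]
  have h10 : (m : ℝ) = ε := by
    calc (m : ℝ) = ε * (ε * m) := by rw [← mul_assoc, hε2, one_mul]
      _ = ε := by rw [h5, mul_one]
  rw [hm, h10]

theorem isSignedLift_of_homeomorph {φ : Circle ≃ₜ Circle} {ε : ℝ} (hε : ε = 1 ∨ ε = -1)
    {f g : C(ℝ, ℝ)} (hfg : ∀ t, f (g t) = t)
    (hf : StrictMono fun x => ε * f x) (hexp : ∀ t, Circle.exp (f t) = φ (Circle.exp t)) :
    IsSignedLift ε f where
  sign_mul_self := by rcases hε with rfl | rfl <;> norm_num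
  continuous := f.continuous
  strictMono := hf
  add_two_pi := lift_add_two_pi φ.injective hε hfg hf hexp

theorem exists_signed_lifts (φ : Circle ≃ₜ Circle) :
    ∃ (ε : ℝ) (f g : ℝ → ℝ), IsSignedLift ε f ∧ IsSignedLift ε g ∧ (∀ t, g (f t) = t) ∧
      (∀ t, f (g t) = t) ∧ ∀ t, Circle.exp (f t) = φ (Circle.exp t) := by
  obtain ⟨f, g, hgf, hfg, hexp⟩ := exists_inverse_lifts φ
  have hexp' : ∀ t, Circle.exp (g t) = φ.symm (Circle.exp t) := fun t => by
    rw [← φ.injective.eq_iff, ← hexp, hfg, φ.apply_symm_apply]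
  obtain ⟨ε, hε, hf⟩ : ∃ ε : ℝ, (ε = 1 ∨ ε = -1) ∧ StrictMono fun x => ε * f x := by
    rcases f.continuous.strictMono_of_inj (Function.LeftInverse.injective hgf) with h | h
    · exact ⟨1, .inl rfl, by simpa using h⟩
    · exact ⟨-1, .inr rfl, by simpa using h.neg⟩
  have hg : StrictMono fun x => ε * g x := by
    rcases hε with rfl | rfl
    · intro a b hab
      have := hf.lt_iff_lt (a := g a) (b := g b)
      simp only [hfg, one_mul] at this ⊢
      exact this.1 hab
    · intro a b hab
      have := hf.lt_iff_lt (a := g b) (b := g a)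
      simp only [hfg, neg_mul, one_mul, neg_lt_neg_iff] at this ⊢
      exact this.1 hab
  exact ⟨ε, f, g, isSignedLift_of_homeomorph hε hfg hf hexp,
    isSignedLift_of_homeomorph hε hgf hg hexp', hgf, hfg, hexp⟩

/-! ### Shearing the graph of a lift -/

/-- The source coordinate of the point of the sheared graph of `f` at height `y`. -/
def shearSource (ε : ℝ) (f : ℝ → ℝ) (x y : ℝ) : ℝ := (x + y * (ε * f x)) / (1 + y)

/-- The target coordinate of the point of the sheared graph of `f` at height `y`. -/
def shearTarget (ε : ℝ) (f : ℝ → ℝ) (x y : ℝ) : ℝ := (f x + y * (ε * x)) / (1 + y)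

/-- The parameter of the point of the sheared graph above `w`. -/
def shearFoot (ε : ℝ) (f : ℝ → ℝ) (w y : ℝ) : ℝ :=
  Function.invFun (fun x => shearSource ε f x y) w

/-- The isotopy from `f` (at `y = 0`) to `ε • id` (at `y = 1`) whose graphs are the sheared
graphs of `f`. -/
def shearIsotopy (ε : ℝ) (f : ℝ → ℝ) (w y : ℝ) : ℝ := shearTarget ε f (shearFoot ε f w y) y

namespace IsSignedLift

variable {ε : ℝ} {f g : ℝ → ℝ}

theorem abs_sign (hf : IsSignedLift ε f) : |ε| = 1 := by
  have := hf.sign_mul_self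
  rw [← abs_mul_abs_self] at this
  nlinarith [abs_nonneg ε]

theorem exists_abs_sub_le (hf : IsSignedLift ε f) : ∃ C, 0 ≤ C ∧ ∀ x, |ε * f x - x| ≤ C := by
  have hper : Function.Periodic (fun x => ε * f x - x) (2 * Real.pi) := fun x => by
    simp only [hf.add_two_pi, mul_add, ← mul_assoc, hf.sign_mul_self]
    ring
  have hcont : Continuous fun x => ε * f x - x :=
    (continuous_const.mul hf.continuous).sub continuous_id
  obtain ⟨C, hC⟩ := (hper.isBounded_of_continuous Real.two_pi_pos.ne' hcont).exists_norm_le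
  refine ⟨C, (norm_nonneg _).trans (hC _ ⟨0, rfl⟩), fun x => hC _ ⟨x, rfl⟩⟩

/-- The increments of `x` and of `ε f` have the same sign, so they cannot cancel. -/
theorem abs_sub_le_shearSource_sub (hf : IsSignedLift ε f) {y : ℝ} (hy : 0 ≤ y) (x x' : ℝ) :
    |x - x'| ≤ (1 + y) * |shearSource ε f x y - shearSource ε f x' y| := by
  have h1 : (1 + y) * |shearSource ε f x y - shearSource ε f x' y|
      = |(x - x') + y * (ε * f x - ε * f x')| := by
    have hp : 0 < 1 + y := by positivity
    conv_lhs => rw [← abs_of_pos hp, ← abs_mul]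
    congr 1
    simp only [shearSource]
    field_simp
    ring
  rw [h1]
  rcases le_total x x' with h | h
  · have h2 := mul_nonneg hy (sub_nonneg.2 (hf.strictMono.monotone h))
    rw [abs_of_nonpos (by linarith)]
    refine le_trans ?_ (neg_le_abs _)
    linarith
  · have h2 := mul_nonneg hy (sub_nonneg.2 (hf.strictMono.monotone h))
    rw [abs_of_nonneg (by linarith)]
    refine le_trans ?_ (le_abs_self _)
    linarith

theorem shearSource_strictMono (hf : IsSignedLift ε f) {y : ℝ} (hy : 0 ≤ y) :
    StrictMono fun x => shearSource ε f x y := by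
  intro a b hab
  have := mul_le_mul_of_nonneg_left (hf.strictMono hab).le hy
  simp only at this
  simp only [shearSource]
  gcongr ?_ / _
  linarith

theorem shearSource_sub_self (y x : ℝ) (hy : 0 ≤ y) :
    shearSource ε f x y = x + y / (1 + y) * (ε * f x - x) := by
  have hp : 0 < 1 + y := by positivity
  simp only [shearSource]
  field_simp
  ring

theorem continuous_shearSource (hf : IsSignedLift ε f) (y : ℝ) :
    Continuous fun x => shearSource ε f x y := by
  have := hf.continuous
  unfold shearSource
  fun_prop

theorem shearSource_surjective (hf : IsSignedLift ε f) {y : ℝ} (hy : 0 ≤ y) :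
    Function.Surjective fun x => shearSource ε f x y := by
  obtain ⟨C, hC0, hC⟩ := hf.exists_abs_sub_le
  have hs : |y / (1 + y)| ≤ 1 := by
    rw [abs_of_nonneg (by positivity)]
    exact (div_le_one (by positivity)).2 (by linarith)
  have hb : ∀ x, |shearSource ε f x y - x| ≤ C := fun x => by
    rw [shearSource_sub_self y x hy, add_sub_cancel_left, abs_mul]
    exact (mul_le_mul hs (hC x) (abs_nonneg _) zero_le_one).trans_eq (one_mul C)
  refine (hf.continuous_shearSource y).surjective ?_ ?_
  · refine tendsto_atTop_mono (fun x => ?_) (tendsto_atTop_add_const_right _ (-C) tendsto_id)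
    have := (abs_le.1 (hb x)).1
    simp only [id]
    linarith
  · refine tendsto_atBot_mono (fun x => ?_) (tendsto_atBot_add_const_right _ C tendsto_id)
    have := (abs_le.1 (hb x)).2
    simp only [id]
    linarith

theorem shearSource_shearFoot (hf : IsSignedLift ε f) {y : ℝ} (hy : 0 ≤ y) (w : ℝ) :
    shearSource ε f (shearFoot ε f w y) y = w :=
  Function.rightInverse_invFun (hf.shearSource_surjective hy) w

theorem shearFoot_shearSource (hf : IsSignedLift ε f) {y : ℝ} (hy : 0 ≤ y) (x : ℝ) :
    shearFoot ε f (shearSource ε f x y) y = x :=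
  Function.leftInverse_invFun (hf.shearSource_strictMono hy).injective x

theorem shearIsotopy_shearSource (hf : IsSignedLift ε f) {y : ℝ} (hy : 0 ≤ y) (x : ℝ) :
    shearIsotopy ε f (shearSource ε f x y) y = shearTarget ε f x y := by
  rw [shearIsotopy, hf.shearFoot_shearSource hy]

theorem shearIsotopy_zero (hf : IsSignedLift ε f) (w : ℝ) : shearIsotopy ε f w 0 = f w := by
  simpa [shearSource, shearTarget] using hf.shearIsotopy_shearSource le_rfl w

theorem shearIsotopy_add_two_pi (hf : IsSignedLift ε f) {y : ℝ} (hy : 0 ≤ y) (w : ℝ) :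
    shearIsotopy ε f (w + 2 * Real.pi) y = shearIsotopy ε f w y + ε * (2 * Real.pi) := by
  have hp : 0 < 1 + y := by positivity
  obtain ⟨x, rfl⟩ := hf.shearSource_surjective hy w
  have h1 : shearSource ε f x y + 2 * Real.pi = shearSource ε f (x + 2 * Real.pi) y := by
    simp only [shearSource, hf.add_two_pi, mul_add, ← mul_assoc ε ε, hf.sign_mul_self]
    field_simp
    ring
  simp only [h1, hf.shearIsotopy_shearSource hy, shearTarget, hf.add_two_pi]
  field_simp
  ring

/-- Swapping coordinates turns the sheared graph of `f` into that of `g`, with `f x` as the new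
parameter. -/
theorem shearIsotopy_leftInverse (hf : IsSignedLift ε f) (hg : IsSignedLift ε g)
    (hgf : ∀ t, g (f t) = t) {y : ℝ} (hy : 0 ≤ y) (w : ℝ) :
    shearIsotopy ε g (shearIsotopy ε f w y) y = w := by
  obtain ⟨x, rfl⟩ := hf.shearSource_surjective hy w
  have h1 : shearTarget ε f x y = shearSource ε g (f x) y := by
    simp only [shearSource, shearTarget, hgf]
  simp only [hf.shearIsotopy_shearSource hy, h1, hg.shearIsotopy_shearSource hy]
  simp only [shearSource, shearTarget, hgf]

theorem abs_div_one_add_sub_le {y y' : ℝ} (hy : 0 ≤ y) (hy' : 0 ≤ y') :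
    |y / (1 + y) - y' / (1 + y')| ≤ |y - y'| := by
  have hp : 0 < 1 + y := by positivity
  have hp' : 0 < 1 + y' := by positivity
  have : y / (1 + y) - y' / (1 + y') = (y - y') / ((1 + y) * (1 + y')) := by
    field_simp
    ring
  rw [this, abs_div, abs_of_pos (mul_pos hp hp')]
  exact div_le_self (abs_nonneg _) (by nlinarith)

theorem abs_shearSource_sub_le {C : ℝ} (hC : ∀ x, |ε * f x - x| ≤ C) {y y' : ℝ} (hy : 0 ≤ y)
    (hy' : 0 ≤ y') (x : ℝ) :
    |shearSource ε f x y - shearSource ε f x y'| ≤ C * |y - y'| := by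
  have : shearSource ε f x y - shearSource ε f x y'
      = (ε * f x - x) * (y / (1 + y) - y' / (1 + y')) := by
    rw [shearSource_sub_self y x hy, shearSource_sub_self y' x hy']
    ring
  rw [this, abs_mul]
  exact mul_le_mul (hC x) (abs_div_one_add_sub_le hy hy') (abs_nonneg _)
    ((abs_nonneg _).trans (hC x))

theorem abs_shearTarget_sub_le (hf : IsSignedLift ε f) {C : ℝ} (hC : ∀ x, |ε * f x - x| ≤ C)
    {y y' : ℝ} (hy : 0 ≤ y) (hy' : 0 ≤ y') (x : ℝ) :
    |shearTarget ε f x y - shearTarget ε f x y'| ≤ C * |y - y'| := by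
  have hp : 0 < 1 + y := by positivity
  have hp' : 0 < 1 + y' := by positivity
  have : shearTarget ε f x y - shearTarget ε f x y'
      = (-ε * (ε * f x - x)) * (y / (1 + y) - y' / (1 + y')) := by
    simp only [shearTarget]
    field_simp
    linear_combination f x * (y - y') * hf.sign_mul_self
  rw [this, abs_mul, abs_mul, abs_neg, hf.abs_sign, one_mul]
  exact mul_le_mul (hC x) (abs_div_one_add_sub_le hy hy') (abs_nonneg _)
    ((abs_nonneg _).trans (hC x))

/-- This bound does not degenerate as `y → 0`, so the isotopy is continuous up to `y = 0`, where its
Lipschitz bounds are lost. -/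
theorem abs_shearFoot_sub_le (hf : IsSignedLift ε f) {C : ℝ} (hC : ∀ x, |ε * f x - x| ≤ C)
    {y y' : ℝ} (hy : 0 ≤ y) (hy1 : y ≤ 1) (hy' : 0 ≤ y') (w w' : ℝ) :
    |shearFoot ε f w y - shearFoot ε f w' y'| ≤ 2 * (|w - w'| + C * |y - y'|) := by
  refine (hf.abs_sub_le_shearSource_sub hy _ _).trans ?_
  refine mul_le_mul (by linarith) ?_ (abs_nonneg _) zero_le_two
  rw [hf.shearSource_shearFoot hy]
  have h1 := abs_shearSource_sub_le hC hy hy' (shearFoot ε f w' y')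
  rw [hf.shearSource_shearFoot hy', abs_sub_comm] at h1
  exact (abs_sub_le w w' _).trans (by linarith)

theorem continuousOn_shearIsotopy (hf : IsSignedLift ε f) :
    ContinuousOn (fun q : ℝ × ℝ => shearIsotopy ε f q.1 q.2) (univ ×ˢ Icc 0 1) := by
  obtain ⟨C, hC0, hC⟩ := hf.exists_abs_sub_le
  have hfoot : ContinuousOn (fun q : ℝ × ℝ => shearFoot ε f q.1 q.2) (univ ×ˢ Icc 0 1) := by
    intro q hq
    rw [ContinuousWithinAt, tendsto_iff_dist_tendsto_zero]
    have hlim : Tendsto (fun q' : ℝ × ℝ => 2 * (|q'.1 - q.1| + C * |q'.2 - q.2|))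
        (𝓝[univ ×ˢ Icc 0 1] q) (𝓝 0) := by
      have : Continuous fun q' : ℝ × ℝ => 2 * (|q'.1 - q.1| + C * |q'.2 - q.2|) := by fun_prop
      simpa using (this.tendsto q).mono_left nhdsWithin_le_nhds
    refine squeeze_zero' (Eventually.of_forall fun _ => dist_nonneg) ?_ hlim
    filter_upwards [self_mem_nhdsWithin] with q' hq'
    exact hf.abs_shearFoot_sub_le hC hq'.2.1 hq'.2.2 hq.2.1 _ _
  have hfc := hf.continuous
  simp only [shearIsotopy, shearTarget]
  refine ContinuousOn.div ?_ (by fun_prop) fun q hq => ?_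
  · exact (hfc.comp_continuousOn hfoot).add
      (continuous_snd.continuousOn.mul (continuousOn_const.mul hfoot))
  · have := hq.2.1
    positivity

/-- The difference of the squares is `a²(1 - y⁴) + 2aby(1 - y²)`. With `a`, `b` the increments of
`x` and `ε f`, this is the `1/y` slope bound. -/
theorem abs_add_mul_mul_le {a b y : ℝ} (hab : 0 ≤ a * b) (hy : 0 ≤ y) (hy1 : y ≤ 1) :
    |(b + y * a) * y| ≤ |a + y * b| := by
  rw [← sq_le_sq]
  have h1 : y ^ 2 ≤ 1 := by nlinarith
  have h2 : 0 ≤ a ^ 2 * ((1 - y ^ 2) * (1 + y ^ 2)) := by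
    have : 0 ≤ 1 - y ^ 2 := by linarith
    positivity
  have h3 : 0 ≤ a * b * (2 * y * (1 - y ^ 2)) := by
    have : 0 ≤ 1 - y ^ 2 := by linarith
    positivity
  linarith

theorem abs_shearIsotopy_sub_left_le (hf : IsSignedLift ε f) {y : ℝ} (hy : 0 < y) (hy1 : y ≤ 1)
    (w w' : ℝ) : |shearIsotopy ε f w y - shearIsotopy ε f w' y| ≤ |w - w'| / y := by
  have hp : 0 < 1 + y := by positivity
  obtain ⟨x, rfl⟩ := hf.shearSource_surjective hy.le w
  obtain ⟨x', rfl⟩ := hf.shearSource_surjective hy.le w'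
  simp only [hf.shearIsotopy_shearSource hy.le]
  have h1 : shearTarget ε f x y - shearTarget ε f x' y
      = ε * ((ε * f x - ε * f x' + y * (x - x')) / (1 + y)) := by
    simp only [shearTarget]
    field_simp
    linear_combination (f x' - f x) * hf.sign_mul_self
  have h2 : shearSource ε f x y - shearSource ε f x' y
      = (x - x' + y * (ε * f x - ε * f x')) / (1 + y) := by
    simp only [shearSource]
    field_simp
    ring
  rw [h1, h2, le_div_iff₀ hy, abs_mul, hf.abs_sign, one_mul, abs_div, abs_div, div_mul_eq_mul_div]
  gcongr ?_ / _
  rw [← abs_of_pos hy, ← abs_mul, abs_of_pos hy]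
  refine abs_add_mul_mul_le ?_ hy.le hy1
  rcases le_total x x' with h | h
  · exact mul_nonneg_of_nonpos_of_nonpos (sub_nonpos.2 h)
      (sub_nonpos.2 (hf.strictMono.monotone h))
  · exact mul_nonneg (sub_nonneg.2 h) (sub_nonneg.2 (hf.strictMono.monotone h))

/-- Follow the curve of fixed parameter `x` from height `y` to `y'`: each coordinate moves by at
most `C|y - y'|`. Returning to abscissa `w` at height `y'` costs the slope factor `1/y'`. -/
theorem abs_shearIsotopy_sub_right_le (hf : IsSignedLift ε f) {C : ℝ}
    (hC : ∀ x, |ε * f x - x| ≤ C) {y y' : ℝ} (hy : 0 ≤ y) (hy' : 0 < y') (hy1' : y' ≤ 1) (w : ℝ) :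
    |shearIsotopy ε f w y - shearIsotopy ε f w y'| ≤ C * |y - y'| * (1 + 1 / y') := by
  obtain ⟨x, rfl⟩ := hf.shearSource_surjective hy w
  have h1 := hf.abs_shearTarget_sub_le hC hy hy'.le x
  have h2 := (hf.abs_shearIsotopy_sub_left_le hy' hy1' (shearSource ε f x y')
    (shearSource ε f x y))
  have h3 : |shearSource ε f x y' - shearSource ε f x y| / y' ≤ C * |y - y'| / y' := by
    rw [abs_sub_comm]
    gcongr
    exact abs_shearSource_sub_le hC hy hy'.le x
  rw [hf.shearIsotopy_shearSource hy'.le] at h2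
  simp only [hf.shearIsotopy_shearSource hy]
  calc _ ≤ |shearTarget ε f x y - shearTarget ε f x y'| + _ := abs_sub_le _ _ _
    _ ≤ C * |y - y'| + C * |y - y'| / y' := add_le_add h1 (h2.trans h3)
    _ = _ := by ring

end IsSignedLift

/-! ### Twist profiles -/

/-- The quantitative regularity of an angular isotopy `F w y`, `0 < y ≤ 1`, that makes the
disk map `r e^{iw} ↦ r e^{iF(w, 1 - r)}` Sobolev regular. -/
structure IsTwistProfile (C : ℝ) (F : ℝ → ℝ → ℝ) : Prop where
  nonneg : 0 ≤ C
  abs_sub_left_le : ∀ {y : ℝ}, 0 < y → y ≤ 1 → ∀ w w', |F w y - F w' y| ≤ |w - w'| / y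
  abs_sub_right_le : ∀ {y y' : ℝ}, 0 < y → 0 < y' → y' ≤ 1 → ∀ w,
    |F w y - F w y'| ≤ C * |y - y'| * (1 + 1 / y')
  exists_curve : ∀ {y : ℝ}, 0 < y → ∀ w, ∃ (α β : ℝ → ℝ) (α' β' : ℝ), HasDerivAt α α' y ∧
    HasDerivAt β β' y ∧ |α'| ≤ C ∧ |β'| ≤ C ∧ α y = w ∧ ∀ᶠ t in 𝓝 y, F (α t) t = β t

theorem hasDerivAt_add_mul_div_one_add (a b : ℝ) {y : ℝ} (hy : 0 < y) :
    HasDerivAt (fun t => (a + t * b) / (1 + t)) ((b - a) / (1 + y) ^ 2) y := by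
  have hp : 0 < 1 + y := by positivity
  have h := (((hasDerivAt_id y).mul_const b).const_add a).div ((hasDerivAt_id y).const_add 1) hp.ne'
  refine h.congr_deriv ?_
  simp only [id]
  ring

theorem abs_div_one_add_sq_le {a C y : ℝ} (hy : 0 < y) (ha : |a| ≤ C) :
    |a / (1 + y) ^ 2| ≤ C := by
  have hp : 1 ≤ (1 + y) ^ 2 := by nlinarith
  rw [abs_div, abs_of_pos (by positivity : 0 < (1 + y) ^ 2)]
  exact (div_le_self (abs_nonneg _) hp).trans ha

theorem IsSignedLift.exists_isTwistProfile {ε : ℝ} {f : ℝ → ℝ} (hf : IsSignedLift ε f) :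
    ∃ C, IsTwistProfile C (shearIsotopy ε f) := by
  obtain ⟨C, hC0, hC⟩ := hf.exists_abs_sub_le
  refine ⟨C, hC0, hf.abs_shearIsotopy_sub_left_le,
    fun hy hy' hy1' w => hf.abs_shearIsotopy_sub_right_le hC hy.le hy' hy1' w, fun {y} hy w => ?_⟩
  obtain ⟨x, rfl⟩ := hf.shearSource_surjective hy.le w
  have hx : |ε * x - f x| ≤ C := by
    have : ε * x - f x = -ε * (ε * f x - x) := by
      linear_combination (f x) * hf.sign_mul_self
    rw [this, abs_mul, abs_neg, hf.abs_sign, one_mul]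
    exact hC x
  refine ⟨fun t => shearSource ε f x t, fun t => shearTarget ε f x t, _, _,
    hasDerivAt_add_mul_div_one_add x (ε * f x) hy, hasDerivAt_add_mul_div_one_add (f x) (ε * x) hy,
    abs_div_one_add_sq_le hy (hC x), abs_div_one_add_sq_le hy hx, rfl, ?_⟩
  filter_upwards [lt_mem_nhds hy] with t ht
  exact hf.shearIsotopy_shearSource ht.le x

/-! ### Weak differentials of locally Lipschitz maps -/

theorem integral_fderiv_mul_eq_of_lipschitzWith_real {K : NNReal} {u : ℂ → ℝ}
    (hu : LipschitzWith K u) {η : ℂ → ℝ} (hη : ContDiff ℝ ∞ η) (hηc : HasCompactSupport η) (v : ℂ) :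
    ∫ z, fderiv ℝ η z v * u z = -∫ z, η z * fderiv ℝ u z v := by
  obtain ⟨D, hD⟩ := hη.lipschitzWith_of_hasCompactSupport hηc (by simp)
  have h := hu.integral_lineDeriv_mul_eq (μ := volume) hD hηc v
  have h1 : ∫ z, lineDeriv ℝ u z v * η z = ∫ z, η z * fderiv ℝ u z v := by
    refine integral_congr_ae ?_
    filter_upwards [hu.ae_differentiableAt (μ := volume)] with z hz
    rw [hz.lineDeriv_eq_fderiv, mul_comm]
  have h2 : ∫ z, lineDeriv ℝ η z (-v) * u z = -∫ z, fderiv ℝ η z v * u z := by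
    rw [← integral_neg]
    refine integral_congr_ae (Eventually.of_forall fun z => ?_)
    simp only [(hη.differentiable (by simp) z).lineDeriv_eq_fderiv, map_neg, neg_mul]
  rw [← h1, h, h2, neg_neg]

theorem integrable_smul_fderiv_of_lipschitzWith {K : NNReal} {u : ℂ → ℂ}
    (hu : LipschitzWith K u) {η : ℂ → ℝ} (hη : Continuous η) (hηc : HasCompactSupport η) (v : ℂ) :
    Integrable fun z => η z • fderiv ℝ u z v := by
  refine (hη.integrable_of_hasCompactSupport hηc).smul_bdd (K * ‖v‖)
    (measurable_fderiv_apply_const ℝ u v).aestronglyMeasurable (Eventually.of_forall fun z => ?_)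
  exact ((fderiv ℝ u z).le_opNorm v).trans
    (mul_le_mul_of_nonneg_right (norm_fderiv_le_of_lipschitz ℝ hu) (norm_nonneg _))

theorem integrable_fderiv_smul_of_continuous {u : ℂ → ℂ} (hu : Continuous u) {η : ℂ → ℝ}
    (hη : ContDiff ℝ ∞ η) (hηc : HasCompactSupport η) (v : ℂ) :
    Integrable fun z => fderiv ℝ η z v • u z := by
  refine Continuous.integrable_of_hasCompactSupport ?_ ?_
  · exact ((hη.continuous_fderiv (by simp)).clm_apply continuous_const).smul hu
  · exact (hηc.fderiv_apply ℝ v).smul_right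

theorem integral_fderiv_smul_eq_of_lipschitzWith {K : NNReal} {u : ℂ → ℂ}
    (hu : LipschitzWith K u) {η : ℂ → ℝ} (hη : ContDiff ℝ ∞ η) (hηc : HasCompactSupport η) (v : ℂ) :
    ∫ z, fderiv ℝ η z v • u z = -∫ z, η z • fderiv ℝ u z v := by
  have key : ∀ L : ℂ →L[ℝ] ℝ, L (∫ z, fderiv ℝ η z v • u z)
      = L (-∫ z, η z • fderiv ℝ u z v) := fun L => by
    rw [map_neg, ← L.integral_comp_comm (integrable_fderiv_smul_of_continuous hu.continuous hη hηc v),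
      ← L.integral_comp_comm (integrable_smul_fderiv_of_lipschitzWith hu hη.continuous hηc v)]
    have h := integral_fderiv_mul_eq_of_lipschitzWith_real (L.lipschitz.comp hu) hη hηc v
    simp only [map_smul, smul_eq_mul]
    refine h.trans (congrArg _ (integral_congr_ae ?_))
    filter_upwards [hu.ae_differentiableAt (μ := volume)] with z hz
    rw [(L.hasFDerivAt.comp z hz.hasFDerivAt).fderiv]
    rfl
  exact Complex.ext (key Complex.reCLM) (key Complex.imCLM)

/-- Each compact part of `U` has an open neighbourhood on which `f` is Lipschitz. -/
def LipschitzNearCompacts (U : Set ℂ) (f : ℂ → ℂ) : Prop :=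
  ∀ A, IsCompact A → A ⊆ U → ∃ (V : Set ℂ) (K : NNReal), IsOpen V ∧ A ⊆ V ∧ LipschitzOnWith K f V

/-- Only values near the support of `η` matter, and there `f` agrees with a globally Lipschitz map.
-/
theorem LipschitzNearCompacts.integral_fderiv_smul_eq {U : Set ℂ} {f : ℂ → ℂ}
    (hf : LipschitzNearCompacts U f) {η : ℂ → ℝ} (hη : ContDiff ℝ ∞ η) (hηc : HasCompactSupport η)
    (hηU : tsupport η ⊆ U) (v : ℂ) :
    ∫ z in U, fderiv ℝ η z v • f z = -∫ z in U, η z • fderiv ℝ f z v := by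
  obtain ⟨V, K, hV, hηV, hfV⟩ := hf _ hηc hηU
  obtain ⟨u, hu, huf⟩ := hfV.extend_finite_dimension
  have h1 : ∀ z ∉ tsupport η, fderiv ℝ η z v = 0 := fun z hz => by
    rw [fderiv_of_notMem_tsupport ℝ hz]
    rfl
  have h2 : ∀ z ∉ tsupport η, η z = 0 := fun z hz => image_eq_zero_of_notMem_tsupport hz
  rw [setIntegral_eq_integral_of_forall_compl_eq_zero
      (fun z hz => by rw [h1 z fun h => hz (hηU h), zero_smul]),
    setIntegral_eq_integral_of_forall_compl_eq_zero
      (fun z hz => by rw [h2 z fun h => hz (hηU h), zero_smul])]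
  have h3 : (fun z => fderiv ℝ η z v • f z) = fun z => fderiv ℝ η z v • u z := by
    funext z
    by_cases hz : z ∈ tsupport η
    · rw [huf (hηV hz)]
    · rw [h1 z hz, zero_smul, zero_smul]
  have h4 : (fun z => η z • fderiv ℝ f z v) = fun z => η z • fderiv ℝ u z v := by
    funext z
    by_cases hz : z ∈ tsupport η
    · rw [(huf.eventuallyEq_of_mem (hV.mem_nhds (hηV hz))).fderiv_eq]
    · rw [h2 z hz, zero_smul, zero_smul]
  rw [h3, h4, integral_fderiv_smul_eq_of_lipschitzWith hu hη hηc v]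

theorem LipschitzNearCompacts.memSobolevOne {U : Set ℂ} (hU : volume U ≠ ⊤) {f : ℂ → ℂ}
    (hf : LipschitzNearCompacts U f) {p : ℝ≥0∞} (hp : 1 ≤ p) (hfp : MemLp f p (volume.restrict U))
    (hfp' : MemLp (fderiv ℝ f) p (volume.restrict U)) : MemSobolevOne U p f := by
  have : IsFiniteMeasure (volume.restrict U) := isFiniteMeasure_restrict.2 hU
  have h1 : IntegrableOn f U := hfp.integrable hp
  have h2 : IntegrableOn (fderiv ℝ f) U := hfp'.integrable hp
  exact ⟨hfp, fderiv ℝ f, ⟨h1.locallyIntegrableOn, h2.locallyIntegrableOn,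
    fun η hη hηc hηU v => hf.integral_fderiv_smul_eq hη hηc hηU v⟩, hfp'⟩

/-- Rademacher's theorem on countably many open sets covering `U`. -/
theorem LipschitzNearCompacts.ae_differentiableAt {U : Set ℂ} (hU : IsOpen U) {f : ℂ → ℂ}
    (hf : LipschitzNearCompacts U f) : ∀ᵐ z ∂volume.restrict U, DifferentiableAt ℝ f z := by
  rw [ae_restrict_iff' hU.measurableSet]
  have hloc : ∀ z : U, ∃ (V : Set ℂ), IsOpen V ∧ z.1 ∈ V ∧
      ∀ᵐ x ∂volume, x ∈ V → DifferentiableAt ℝ f x := fun z => by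
    obtain ⟨V, K, hV, hzV, hfV⟩ := hf {z.1} isCompact_singleton (by simp)
    refine ⟨V, hV, hzV rfl, ?_⟩
    filter_upwards [hfV.ae_differentiableWithinAt_of_mem (μ := volume)] with x hx hxV
    exact (hx hxV).differentiableAt (hV.mem_nhds hxV)
  choose V hV hzV hVd using hloc
  obtain ⟨T, hT, hTU⟩ := TopologicalSpace.isOpen_iUnion_countable V hV
  filter_upwards [(ae_ball_iff hT).2 fun z _ => hVd z] with x hx hxU
  have : x ∈ ⋃ i ∈ T, V i := by
    rw [hTU]
    exact mem_iUnion.2 ⟨⟨x, hxU⟩, hzV _⟩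
  obtain ⟨i, hi, hxi⟩ := mem_iUnion₂.1 this
  exact hx i hi hxi

/-! ### Real-linear maps of the plane in unit frames -/

theorem Complex.det_real_linearMap (L : ℂ →ₗ[ℝ] ℂ) :
    LinearMap.det L = (L 1).re * (L Complex.I).im - (L Complex.I).re * (L 1).im := by
  rw [← LinearMap.det_toMatrix Complex.basisOneI, Matrix.det_fin_two]
  simp [LinearMap.toMatrix_apply]

section Frame

variable {D : ℂ →L[ℝ] ℂ} {e E : ℂ} {a b : ℝ}

theorem apply_eq_of_unit_frame (he : ‖e‖ = 1) (v : ℂ) :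
    D v = (v * starRingEnd ℂ e).re • D e + (v * starRingEnd ℂ e).im • D (Complex.I * e) := by
  have h : v = (v * starRingEnd ℂ e).re • e + (v * starRingEnd ℂ e).im • (Complex.I * e) := by
    have h1 : starRingEnd ℂ e * e = 1 := by
      rw [mul_comm, Complex.mul_conj, Complex.normSq_eq_norm_sq, he]
      simp
    rw [Complex.real_smul, Complex.real_smul, ← mul_assoc, ← add_mul, mul_comm (Complex.ofReal _) Complex.I,
      mul_comm Complex.I, Complex.re_add_im, mul_assoc, h1, mul_one]
  conv_lhs => rw [h]
  rw [map_add, map_smul, map_smul]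

theorem opNorm_le_of_unit_frame (he : ‖e‖ = 1) : ‖D‖ ≤ ‖D e‖ + ‖D (Complex.I * e)‖ := by
  refine D.opNorm_le_bound (by positivity) fun v => ?_
  have hv : ‖v * starRingEnd ℂ e‖ = ‖v‖ := by simp [he]
  rw [apply_eq_of_unit_frame (D := D) he v]
  refine (norm_add_le _ _).trans ?_
  rw [norm_smul, norm_smul, add_mul, mul_comm ‖D e‖, mul_comm ‖D _‖, ← hv]
  gcongr
  · exact Complex.abs_re_le_norm _
  · exact Complex.abs_im_le_norm _

/-- From the frame `(e, ie)` to `(E, iE)` the matrix is triangular with diagonal `1, a`, and both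
frames are rotations of the standard one. -/
theorem det_eq_of_unit_frame (he : ‖e‖ = 1) (hE : ‖E‖ = 1) (h1 : D e = (1 + b * Complex.I) * E)
    (h2 : D (Complex.I * e) = a * Complex.I * E) : D.det = a := by
  have he' : e.re * e.re + e.im * e.im = 1 := by
    rw [← Complex.normSq_apply, Complex.normSq_eq_norm_sq, he, one_pow]
  have hE' : E.re * E.re + E.im * E.im = 1 := by
    rw [← Complex.normSq_apply, Complex.normSq_eq_norm_sq, hE, one_pow]
  have h3 := apply_eq_of_unit_frame (D := D) he 1
  have h4 := apply_eq_of_unit_frame (D := D) he Complex.I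
  rw [h1, h2] at h3 h4
  rw [ContinuousLinearMap.det, Complex.det_real_linearMap]
  simp only [ContinuousLinearMap.coe_coe]
  rw [h3, h4]
  simp
  linear_combination a * (E.re * E.re + E.im * E.im) * he' + a * hE'

end Frame

/-! ### Twist maps: Lipschitz bounds and differential -/

theorem hasDerivAt_polar {ρ θ : ℝ → ℝ} {ρ' θ' t : ℝ} (hρ : HasDerivAt ρ ρ' t)
    (hθ : HasDerivAt θ θ' t) :
    HasDerivAt (fun t => (ρ t : ℂ) * Complex.exp (θ t * Complex.I))
      ((ρ' + ρ t * θ' * Complex.I) * Complex.exp (θ t * Complex.I)) t := by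
  refine (hρ.ofReal_comp.mul (hθ.ofReal_comp.mul_const Complex.I).cexp).congr_deriv ?_
  ring

theorem norm_exp_sub_exp_le (s t : ℝ) :
    ‖Complex.exp (s * Complex.I) - Complex.exp (t * Complex.I)‖ ≤ |s - t| := by
  have h : Complex.exp (s * Complex.I) - Complex.exp (t * Complex.I)
      = Complex.exp (t * Complex.I) * (Complex.exp (Complex.I * (s - t : ℝ)) - 1) := by
    rw [mul_sub, ← Complex.exp_add, mul_one]
    congr 2
    push_cast
    ring
  rw [h, norm_mul, Complex.norm_exp_ofReal_mul_I, one_mul]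
  exact Real.norm_exp_I_mul_ofReal_sub_one_le

/-- `H` rotates the circle of radius `r ≤ 1` through the angular map `F · (1 - r)`. -/
def IsTwistMap (F : ℝ → ℝ → ℝ) (H : ℂ → ℂ) : Prop :=
  ∀ r w : ℝ, 0 ≤ r → r ≤ 1 →
    H (r * Complex.exp (w * Complex.I)) = r * Complex.exp (F w (1 - r) * Complex.I)

namespace IsTwistMap

variable {F : ℝ → ℝ → ℝ} {H : ℂ → ℂ} {C : ℝ}

theorem norm_apply (hH : IsTwistMap F H) {z : ℂ} (hz : ‖z‖ ≤ 1) : ‖H z‖ = ‖z‖ := by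
  conv_lhs => rw [← Complex.norm_mul_exp_arg_mul_I z]
  rw [hH _ _ (norm_nonneg z) hz, norm_mul, Complex.norm_exp_ofReal_mul_I, mul_one,
    Complex.norm_real, norm_norm]

theorem norm_sub_polar_le (hF : IsTwistProfile C F) (hH : IsTwistMap F H) {ρ r r' w w' : ℝ}
    (hρ : ρ < 1) (hr : 0 ≤ r) (hrρ : r ≤ ρ) (hr' : 0 ≤ r') (hr'ρ : r' ≤ ρ) :
    ‖H (r * Complex.exp (w * Complex.I)) - H (r' * Complex.exp (w' * Complex.I))‖
      ≤ |r - r'| + (r * |w - w'| + 2 * C * |r - r'|) / (1 - ρ) := by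
  have hC := hF.nonneg
  have hρ' : 0 < 1 - ρ := by linarith
  rw [hH r w hr (by linarith), hH r' w' hr' (by linarith)]
  have h1 : |F w (1 - r) - F w' (1 - r)| ≤ |w - w'| / (1 - ρ) :=
    (hF.abs_sub_left_le (by linarith) (by linarith) w w').trans (by gcongr)
  have h2 : |F w' (1 - r) - F w' (1 - r')| ≤ C * |r - r'| * (2 / (1 - ρ)) := by
    refine (hF.abs_sub_right_le (by linarith) (by linarith) (by linarith) w').trans ?_
    have h3 : |1 - r - (1 - r')| = |r - r'| := by
      rw [abs_sub_comm]
      congr 1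
      ring
    rw [h3]
    refine mul_le_mul_of_nonneg_left ?_ (by positivity)
    have h4 : 1 / (1 - r') ≤ 1 / (1 - ρ) := one_div_le_one_div_of_le hρ' (by linarith)
    have h5 : 1 ≤ 1 / (1 - ρ) := (one_le_div hρ').2 (by linarith)
    calc 1 + 1 / (1 - r') ≤ 1 / (1 - ρ) + 1 / (1 - ρ) := add_le_add h5 h4
      _ = 2 / (1 - ρ) := by ring
  have h6 : (r : ℂ) * Complex.exp (F w (1 - r) * Complex.I)
      - r' * Complex.exp (F w' (1 - r') * Complex.I)
      = (r - r' : ℝ) * Complex.exp (F w' (1 - r') * Complex.I)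
        + r * (Complex.exp (F w (1 - r) * Complex.I) - Complex.exp (F w' (1 - r') * Complex.I)) := by
    push_cast
    ring
  rw [h6]
  refine (norm_add_le _ _).trans ?_
  rw [norm_mul, norm_mul, Complex.norm_exp_ofReal_mul_I, mul_one, Complex.norm_real,
    Complex.norm_real, Real.norm_eq_abs, Real.norm_of_nonneg hr]
  gcongr
  have h7 : |F w (1 - r) - F w' (1 - r')| ≤ |w - w'| / (1 - ρ) + C * |r - r'| * (2 / (1 - ρ)) :=
    (abs_sub_le _ _ _).trans (add_le_add h1 h2)
  calc r * _ ≤ r * (|w - w'| / (1 - ρ) + C * |r - r'| * (2 / (1 - ρ))) :=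
        mul_le_mul_of_nonneg_left ((norm_exp_sub_exp_le _ _).trans h7) hr
    _ = (r * |w - w'|) / (1 - ρ) + r * (C * |r - r'| * (2 / (1 - ρ))) := by ring
    _ ≤ (r * |w - w'|) / (1 - ρ) + 1 * (C * |r - r'| * (2 / (1 - ρ))) := by
        gcongr
        linarith
    _ = _ := by ring

/-- Measuring the angle of `z'` relative to `z` avoids the jump of `arg`. The constant is `π/2`,
from angle against chord, times 2, from normalising both points. -/
theorem exists_polar_angle (z : ℂ) {z' : ℂ} (hz : z ≠ 0) (hz' : z' ≠ 0) :
    ∃ w' : ℝ, z' = ‖z'‖ * Complex.exp (w' * Complex.I) ∧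
      ‖z‖ * |z.arg - w'| ≤ Real.pi * ‖z - z'‖ := by
  refine ⟨z.arg + (z' / z).arg, ?_, ?_⟩
  · have h1 := Complex.norm_mul_exp_arg_mul_I z
    have h2 := Complex.norm_mul_exp_arg_mul_I (z' / z)
    have hz0 : (‖z‖ : ℂ) ≠ 0 := by simpa using hz
    calc z' = z * (z' / z) := by field_simp
      _ = (‖z‖ * Complex.exp (z.arg * Complex.I)) *
          (‖z' / z‖ * Complex.exp ((z' / z).arg * Complex.I)) := by rw [h1, h2]
      _ = _ := by
        rw [norm_div]
        push_cast
        rw [add_mul, Complex.exp_add]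
        field_simp
  · have hn : 0 < ‖z‖ := norm_pos_iff.2 hz
    have hn' : 0 < ‖z'‖ := norm_pos_iff.2 hz'
    set u : ℂ := (‖z‖⁻¹ : ℝ) • z
    set u' : ℂ := (‖z'‖⁻¹ : ℝ) • z'
    have hu : ‖u‖ = 1 := norm_smul_inv_norm hz
    have hu' : ‖u'‖ = 1 := norm_smul_inv_norm hz'
    have h1 : |z.arg - (z.arg + (z' / z).arg)| = InnerProductGeometry.angle u' u := by
      rw [InnerProductGeometry.angle_smul_left_of_pos _ _ (inv_pos.2 hn'),
        InnerProductGeometry.angle_smul_right_of_pos _ _ (inv_pos.2 hn),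
        Complex.angle_eq_abs_arg hz' hz, ← abs_neg]
      congr 1
      ring
    have h2 : ‖z‖ * ‖u' - u‖ ≤ 2 * ‖z - z'‖ := by
      have h3 : ‖z‖ • (u' - u) = (z' - z) + (‖z‖ - ‖z'‖) • u' := by
        simp only [u, u', smul_sub, sub_smul, smul_inv_smul₀ hn.ne', smul_inv_smul₀ hn'.ne']
        abel
      rw [← Real.norm_of_nonneg hn.le, ← norm_smul, h3]
      refine (norm_add_le _ _).trans ?_
      rw [norm_smul, hu', mul_one, norm_sub_rev z' z, Real.norm_eq_abs]
      linarith [abs_norm_sub_norm_le z z']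
    rw [h1]
    have h4 := Complex.angle_le_mul_norm_sub hu' hu
    calc ‖z‖ * InnerProductGeometry.angle u' u ≤ ‖z‖ * (Real.pi / 2 * ‖u' - u‖) := by gcongr
      _ = Real.pi / 2 * (‖z‖ * ‖u' - u‖) := by ring
      _ ≤ Real.pi / 2 * (2 * ‖z - z'‖) := by gcongr
      _ = _ := by ring

theorem exists_lipschitzOnWith (hF : IsTwistProfile C F) (hH : IsTwistMap F H) {ρ : ℝ}
    (hρ : ρ < 1) : ∃ K : NNReal, LipschitzOnWith K H (Metric.ball 0 ρ) := by
  have hC := hF.nonneg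
  have hρ' : 0 < 1 - ρ := by linarith
  refine ⟨⟨1 + (Real.pi + 2 * C) / (1 - ρ), by positivity⟩,
    LipschitzOnWith.of_dist_le_mul fun z hz z' hz' => ?_⟩
  rw [mem_ball_zero_iff] at hz hz'
  rw [dist_eq_norm, dist_eq_norm]
  change _ ≤ (1 + (Real.pi + 2 * C) / (1 - ρ)) * _
  have hK : 0 ≤ (Real.pi + 2 * C) / (1 - ρ) := by positivity
  rcases eq_or_ne z 0 with rfl | h0
  · have : H 0 = 0 := by rw [← norm_eq_zero, hH.norm_apply (by simp), norm_zero]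
    rw [this, zero_sub, zero_sub, norm_neg, norm_neg, hH.norm_apply (by linarith)]
    nlinarith [norm_nonneg z']
  rcases eq_or_ne z' 0 with rfl | h0'
  · have : H 0 = 0 := by rw [← norm_eq_zero, hH.norm_apply (by simp), norm_zero]
    rw [this, sub_zero, sub_zero, hH.norm_apply (by linarith)]
    nlinarith [norm_nonneg z]
  obtain ⟨w', hw', hle⟩ := exists_polar_angle z h0 h0'
  have h := norm_sub_polar_le hF hH (w := z.arg) (w' := w') hρ (norm_nonneg z) hz.le
    (norm_nonneg z') hz'.le
  rw [Complex.norm_mul_exp_arg_mul_I, ← hw'] at h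
  have hn := abs_norm_sub_norm_le z z'
  calc _ ≤ _ := h
    _ ≤ ‖z - z'‖ + (Real.pi * ‖z - z'‖ + 2 * C * ‖z - z'‖) / (1 - ρ) := by gcongr
    _ = _ := by ring

theorem lipschitzNearCompacts (hF : IsTwistProfile C F) (hH : IsTwistMap F H) :
    LipschitzNearCompacts openDisk H := by
  intro A hA hA1
  obtain ⟨ρ, hρ, hAρ⟩ := exists_lt_subset_ball hA.isClosed hA1
  obtain ⟨K, hK⟩ := hH.exists_lipschitzOnWith hF hρ
  exact ⟨_, K, Metric.isOpen_ball, hAρ, hK⟩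

/-- The differential of a twist map, in polar frames, is unipotent up to its Jacobian. -/
theorem fderiv_polar_frame (hF : IsTwistProfile C F) (hH : IsTwistMap F H) {r w : ℝ} (hr : 0 < r)
    (hr1 : r < 1) {D : ℂ →L[ℝ] ℂ} (hD : HasFDerivAt H D (r * Complex.exp (w * Complex.I))) :
    ∃ a b : ℝ, |a| ≤ 1 / (1 - r) ∧ |b| ≤ C * (|a| + 1) ∧
      D (Complex.I * Complex.exp (w * Complex.I))
        = a * Complex.I * Complex.exp (F w (1 - r) * Complex.I) ∧
      D (Complex.exp (w * Complex.I))
        = (1 + b * Complex.I) * Complex.exp (F w (1 - r) * Complex.I) := by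
  set e := Complex.exp (w * Complex.I) with he
  set E := Complex.exp (F w (1 - r) * Complex.I) with hE
  have hC := hF.nonneg
  have hy : 0 < 1 - r := by linarith
  have hEn : ‖E‖ = 1 := Complex.norm_exp_ofReal_mul_I _
  have hcirc : HasDerivAt (fun t : ℝ => (r : ℂ) * Complex.exp (F t (1 - r) * Complex.I))
      (D (r * (Complex.I * e))) w := by
    have h1 : HasDerivAt (fun t : ℝ => (r : ℂ) * Complex.exp (t * Complex.I))
        (r * (Complex.I * e)) w := by
      refine (hasDerivAt_polar (hasDerivAt_const w r) (hasDerivAt_id w)).congr_deriv ?_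
      simp [he]
      ring
    have h2 := HasFDerivAt.comp_hasDerivAt w hD h1
    refine h2.congr_of_eventuallyEq (Eventually.of_forall fun t => ?_)
    exact (hH r t hr.le hr1.le).symm
  have hDr : D (r * (Complex.I * e)) = r * D (Complex.I * e) := by
    rw [← Complex.real_smul, map_smul, Complex.real_smul]
  have hbound : ‖D (Complex.I * e)‖ ≤ 1 / (1 - r) := by
    have h1 : ‖D (r * (Complex.I * e))‖ ≤ r * (1 / (1 - r)) := by
      refine hcirc.le_of_lip' (by positivity) (Eventually.of_forall fun t => ?_)
      rw [← mul_sub, norm_mul, Complex.norm_real, Real.norm_of_nonneg hr.le, mul_assoc]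
      refine mul_le_mul_of_nonneg_left ((norm_exp_sub_exp_le _ _).trans
        ((hF.abs_sub_left_le hy (by linarith) t w).trans_eq ?_)) hr.le
      rw [Real.norm_eq_abs]
      ring
    rw [hDr, norm_mul, Complex.norm_real, Real.norm_of_nonneg hr.le] at h1
    exact le_of_mul_le_mul_left h1 hr
  have hE1 : starRingEnd ℂ E * E = 1 := by
    rw [mul_comm, Complex.mul_conj, Complex.normSq_eq_norm_sq, hEn]
    simp
  set q := D (Complex.I * e) * starRingEnd ℂ E with hq
  have hqE : D (Complex.I * e) = q * E := by rw [hq, mul_assoc, hE1, mul_one]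
  -- The image of a circle stays on a circle, so its velocity is orthogonal to `E`.
  have hqre : q.re = 0 := by
    have h1 := hcirc.norm_sq
    have h2 : (fun t : ℝ => ‖(r : ℂ) * Complex.exp (F t (1 - r) * Complex.I)‖ ^ 2)
        = fun _ => r ^ 2 := by
      funext t
      simp [Complex.norm_exp_ofReal_mul_I]
    rw [h2] at h1
    have h3 := h1.unique (hasDerivAt_const w (r ^ 2))
    rw [Complex.inner, hDr, ← hE] at h3
    have h4 : ((r : ℂ) * D (Complex.I * e)) * starRingEnd ℂ ((r : ℂ) * E)
        = ((r ^ 2 : ℝ) : ℂ) * q := by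
      rw [map_mul (starRingEnd ℂ), Complex.conj_ofReal, hq]
      push_cast
      ring
    rw [h4, Complex.re_ofReal_mul] at h3
    have : 0 < r ^ 2 := by positivity
    nlinarith
  obtain ⟨a, ha⟩ : ∃ a : ℝ, q = a * Complex.I := ⟨q.im, by
    apply Complex.ext <;> simp [hqre]⟩
  have hqn : ‖D (Complex.I * e)‖ = |a| := by
    rw [hqE, ha, norm_mul, norm_mul, hEn]
    simp
  obtain ⟨α, β, α', β', hα, hβ, hα', hβ', hαw, hev⟩ := hF.exists_curve hy w
  -- Differentiating `H((1 - t) e^{iα(t)}) = (1 - t) e^{iβ(t)}` at `t = 1 - r` gives `D(-e + rα' ie)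
  -- = (-1 + rβ' i)E`; solving for `D e` yields this `b`.
  refine ⟨a, r * (α' * a - β'), hqn ▸ hbound, ?_, by rw [hqE, ha], ?_⟩
  · rw [abs_mul, abs_of_pos hr]
    have h1 : |α' * a - β'| ≤ C * |a| + C := by
      refine (abs_sub _ _).trans (add_le_add ?_ hβ')
      rw [abs_mul]
      gcongr
    calc r * |α' * a - β'| ≤ 1 * (C * |a| + C) := by gcongr
      _ = _ := by ring
  · have hρ : HasDerivAt (fun t : ℝ => 1 - t) (-1) (1 - r) := by
      simpa using (hasDerivAt_id (1 - r)).const_sub 1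
    have hγ := hasDerivAt_polar hρ hα
    have hδ := hasDerivAt_polar hρ hβ
    have hβF : β (1 - r) = F w (1 - r) := by rw [← hev.self_of_nhds, hαw]
    simp only [hαw, hβF, sub_sub_cancel, ← he, ← hE] at hγ hδ
    have hD' : HasFDerivAt H D ((fun t : ℝ => ((1 - t : ℝ) : ℂ) * Complex.exp (α t * Complex.I))
        (1 - r)) := by
      simpa [hαw] using hD
    have h2 := HasFDerivAt.comp_hasDerivAt (1 - r) hD' hγ
    have h3 : H ∘ (fun t : ℝ => ((1 - t : ℝ) : ℂ) * Complex.exp (α t * Complex.I))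
        =ᶠ[𝓝 (1 - r)] fun t => ((1 - t : ℝ) : ℂ) * Complex.exp (β t * Complex.I) := by
      filter_upwards [hev, lt_mem_nhds hy, gt_mem_nhds (show 1 - r < 1 by linarith)] with t h1 h2 h3
      simp only [Function.comp]
      rw [hH (1 - t) (α t) (by linarith) (by linarith), sub_sub_cancel, h1]
    have h4 := (h2.congr_of_eventuallyEq h3.symm).unique hδ
    have h5 : ((-1 : ℝ) + r * α' * Complex.I) * e
        = (-1 : ℝ) • e + (r * α') • (Complex.I * e) := by
      simp only [Complex.real_smul]
      push_cast
      ring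
    rw [h5, map_add, map_smul, map_smul, hqE, ha] at h4
    simp only [Complex.real_smul] at h4
    push_cast at h4 ⊢
    linear_combination -h4

theorem fderiv_bounds (hF : IsTwistProfile C F) (hH : IsTwistMap F H) {z : ℂ} (hz0 : z ≠ 0)
    (hz : ‖z‖ < 1) (hd : DifferentiableAt ℝ H z) :
    |(fderiv ℝ H z).det| ≤ 1 / (1 - ‖z‖) ∧
      ‖fderiv ℝ H z‖ ≤ (1 + C) * (1 + |(fderiv ℝ H z).det|) := by
  have hD : HasFDerivAt H (fderiv ℝ H z) (‖z‖ * Complex.exp (z.arg * Complex.I)) := by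
    rw [Complex.norm_mul_exp_arg_mul_I]
    exact hd.hasFDerivAt
  obtain ⟨a, b, ha, hb, h1, h2⟩ := hH.fderiv_polar_frame hF (norm_pos_iff.2 hz0) hz hD
  have he := Complex.norm_exp_ofReal_mul_I z.arg
  have hE := Complex.norm_exp_ofReal_mul_I (F z.arg (1 - ‖z‖))
  rw [det_eq_of_unit_frame he hE h2 h1]
  refine ⟨ha, (opNorm_le_of_unit_frame he).trans ?_⟩
  rw [h1, h2, norm_mul, norm_mul, hE]
  have h3 : ‖(1 : ℂ) + b * Complex.I‖ ≤ 1 + |b| := by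
    refine (norm_add_le _ _).trans ?_
    simp
  have h4 : ‖(a : ℂ) * Complex.I‖ = |a| := by simp
  rw [h4]
  linarith

end IsTwistMap

/-! ### Integrability of the differential -/

/-- Powers of the distance to the circle with exponent above `-1` are integrable on the disk. -/
theorem lintegral_one_sub_norm_rpow_lt_top {s : ℝ} (hs : -1 < s) :
    ∫⁻ z in openDisk, ENNReal.ofReal ((1 - ‖z‖) ^ s) < ⊤ := by
  have h : IntegrableOn (fun z : ℂ => (1 - ‖z‖) ^ s) (Metric.ball 0 1) := by
    refine (integrableOn_fun_norm_addHaar volume (f := fun y : ℝ => (1 - y) ^ s)).2 ?_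
    have h1 : IntervalIntegrable (fun y : ℝ => (1 - y) ^ s) volume 0 1 := by
      have := (intervalIntegral.intervalIntegrable_rpow' (a := 0) (b := 1) hs).comp_sub_left 1
      simpa using this.symm
    have h2 := h1.continuousOn_mul (g := fun y : ℝ => y) continuousOn_id
    rw [intervalIntegrable_iff_integrableOn_Ioo_of_le zero_le_one] at h2
    simpa using h2
  exact h.lintegral_lt_top

namespace IsTwistMap

variable {F : ℝ → ℝ → ℝ} {H : ℂ → ℂ} {C : ℝ}

/-- The weight is radial and `H` preserves the modulus, so the left side is the integral of the
weight over an image contained in the disk. -/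
theorem lintegral_det_mul_le (hH : IsTwistMap F H) (hinj : InjOn H openDisk)
    (hdiff : ∀ᵐ z ∂volume.restrict openDisk, DifferentiableAt ℝ H z) (g : ℝ → ℝ≥0∞) :
    ∫⁻ z in openDisk, ENNReal.ofReal |(fderiv ℝ H z).det| * g ‖z‖
      ≤ ∫⁻ z in openDisk, g ‖z‖ := by
  set S : Set ℂ := openDisk ∩ {z | DifferentiableAt ℝ H z}
  have hSm : MeasurableSet S := measurableSet_ball.inter (measurableSet_of_differentiableAt ℝ H)
  have hS : volume.restrict openDisk = volume.restrict S := by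
    refine Measure.restrict_congr_set ?_
    rw [ae_restrict_iff' measurableSet_ball] at hdiff
    filter_upwards [hdiff] with z hz
    exact propext ⟨fun h => ⟨h, hz h⟩, fun h => h.1⟩
  have h1 := lintegral_image_eq_lintegral_abs_det_fderiv_mul volume hSm (f := H)
    (f' := fderiv ℝ H) (fun z hz => (hz.2 : DifferentiableAt ℝ H z).hasFDerivAt.hasFDerivWithinAt)
    (hinj.mono inter_subset_left) (fun z => g ‖z‖)
  have h2 : H '' S ⊆ openDisk := by
    rintro _ ⟨z, hz, rfl⟩
    have hz1 := mem_ball_zero_iff.1 hz.1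
    rw [mem_ball_zero_iff, hH.norm_apply hz1.le]
    exact hz1
  calc _ = ∫⁻ z in S, ENNReal.ofReal |(fderiv ℝ H z).det| * g ‖H z‖ := by
        rw [hS]
        refine setLIntegral_congr_fun hSm fun z hz => ?_
        simp only [hH.norm_apply (mem_ball_zero_iff.1 hz.1).le]
    _ = ∫⁻ z in H '' S, g ‖z‖ := h1.symm
    _ ≤ _ := lintegral_mono_set h2

/-- Split the exponent as `(p - 1) + 1`: the pointwise bound on `J` is spent on the first part only,
leaving one factor `1 + J` for the change of variables. -/
theorem rpow_le_of_le_of_le {x y p M J : ℝ} (hp : 1 ≤ p) (hM : 0 ≤ M) (hx : 0 ≤ x) (hy : 0 < y)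
    (hy1 : y ≤ 1) (hJ : 0 ≤ J) (hJy : J ≤ 1 / y) (hxJ : x ≤ M * (1 + J)) :
    x ^ p ≤ M ^ p * 2 ^ (p - 1) * (y ^ (1 - p) + J * y ^ (1 - p)) := by
  have h1 : 1 + J ≤ 2 / y := by
    have : 1 ≤ 1 / y := (one_le_div hy).2 hy1
    calc 1 + J ≤ 1 / y + 1 / y := add_le_add this hJy
      _ = 2 / y := by ring
  have h2 : (1 + J) ^ (p - 1) ≤ 2 ^ (p - 1) * y ^ (1 - p) := by
    refine (Real.rpow_le_rpow (by positivity) h1 (by linarith)).trans_eq ?_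
    rw [Real.div_rpow zero_le_two hy.le, div_eq_mul_inv, ← Real.rpow_neg hy.le, neg_sub]
  calc x ^ p ≤ (M * (1 + J)) ^ p := Real.rpow_le_rpow hx hxJ (by linarith)
    _ = M ^ p * ((1 + J) ^ (p - 1) * (1 + J)) := by
        rw [Real.mul_rpow hM (by positivity), ← Real.rpow_add_one (by positivity), sub_add_cancel]
    _ ≤ M ^ p * (2 ^ (p - 1) * y ^ (1 - p) * (1 + J)) := by gcongr
    _ = _ := by ring

theorem memLp_fderiv (hF : IsTwistProfile C F) (hH : IsTwistMap F H) (hinj : InjOn H openDisk)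
    {p : ℝ} (hp : 1 ≤ p) (hp2 : p < 2) :
    MemLp (fderiv ℝ H) (ENNReal.ofReal p) (volume.restrict openDisk) := by
  have hp0 : 0 < p := by linarith
  have hdiff := (hH.lipschitzNearCompacts hF).ae_differentiableAt Metric.isOpen_ball
  refine ⟨(measurable_fderiv ℝ H).aestronglyMeasurable, ?_⟩
  rw [eLpNorm_lt_top_iff_lintegral_rpow_enorm_lt_top (by simpa using hp0) ENNReal.ofReal_ne_top,
    ENNReal.toReal_ofReal hp0.le]
  set K : ℝ := (1 + C) ^ p * 2 ^ (p - 1)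
  have hC := hF.nonneg
  have hK : 0 ≤ K := by positivity
  set g : ℝ → ℝ≥0∞ := fun r => ENNReal.ofReal ((1 - r) ^ (1 - p)) with hg
  have hgm : Measurable fun z : ℂ => g ‖z‖ := by fun_prop
  have hgfin : ∫⁻ z in openDisk, g ‖z‖ < ⊤ :=
    -- Here `p < 2` enters, as `1 - p > -1`.
    lintegral_one_sub_norm_rpow_lt_top (by linarith)
  have hae : ∀ᵐ z ∂volume.restrict openDisk, ‖fderiv ℝ H z‖ₑ ^ p
      ≤ ENNReal.ofReal K * (g ‖z‖ + ENNReal.ofReal |(fderiv ℝ H z).det| * g ‖z‖) := by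
    have h0 : ∀ᵐ z ∂volume.restrict openDisk, z ≠ (0 : ℂ) :=
      ae_restrict_of_ae (Measure.ae_ne volume 0)
    filter_upwards [hdiff, h0, ae_restrict_mem measurableSet_ball] with z hz hz0 hz1
    rw [mem_ball_zero_iff] at hz1
    obtain ⟨h1, h2⟩ := hH.fderiv_bounds hF hz0 hz1 hz
    have h3 := rpow_le_of_le_of_le hp (by positivity) (norm_nonneg _) (by linarith)
      (by linarith [norm_nonneg z]) (abs_nonneg _) h1 h2
    have h4 : 0 ≤ (1 - ‖z‖) ^ (1 - p) := Real.rpow_nonneg (by linarith) _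
    rw [← ofReal_norm, ENNReal.ofReal_rpow_of_nonneg (norm_nonneg _) hp0.le, hg,
      ← ENNReal.ofReal_mul (abs_nonneg _), ← ENNReal.ofReal_add h4 (by positivity),
      ← ENNReal.ofReal_mul hK]
    exact ENNReal.ofReal_le_ofReal h3
  refine (lintegral_mono_ae hae).trans_lt ?_
  rw [lintegral_const_mul' _ _ ENNReal.ofReal_ne_top, lintegral_add_left hgm]
  refine ENNReal.mul_lt_top ENNReal.ofReal_lt_top (ENNReal.add_lt_top.2 ⟨hgfin, ?_⟩)
  exact (hH.lintegral_det_mul_le hinj hdiff g).trans_lt hgfin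

theorem memSobolevOne (hF : IsTwistProfile C F) (hH : IsTwistMap F H) (hinj : InjOn H openDisk)
    {p : ℝ} (hp : 1 ≤ p) (hp2 : p < 2) : MemSobolevOne openDisk (ENNReal.ofReal p) H := by
  have hloc := hH.lipschitzNearCompacts hF
  have hvol : volume openDisk ≠ ⊤ := measure_ball_lt_top.ne
  have : IsFiniteMeasure (volume.restrict openDisk) := isFiniteMeasure_restrict.2 hvol
  have hcont : ContinuousOn H openDisk := fun z hz => by
    obtain ⟨V, K, hV, hzV, hK⟩ := hloc {z} isCompact_singleton (by simpa using hz)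
    exact (hK.continuousOn.continuousAt (hV.mem_nhds (hzV rfl))).continuousWithinAt
  refine hloc.memSobolevOne hvol (by simpa using hp) ?_ (hH.memLp_fderiv hF hinj hp hp2)
  refine MemLp.of_bound (hcont.aestronglyMeasurable measurableSet_ball) 1 ?_
  filter_upwards [ae_restrict_mem measurableSet_ball] with z hz
  rw [mem_ball_zero_iff] at hz
  rw [hH.norm_apply hz.le]
  exact hz.le

end IsTwistMap

/-! ### The disk homeomorphism -/

/-- The map `r e^{iw} ↦ r e^{iF(w, 1 - r)}`, with `w` the principal argument. -/
def twistMap (F : ℝ → ℝ → ℝ) (z : ℂ) : ℂ :=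
  ‖z‖ * Complex.exp (F z.arg (1 - ‖z‖) * Complex.I)

theorem IsSignedLift.periodic_exp_shearIsotopy {ε : ℝ} {f : ℝ → ℝ} (hf : IsSignedLift ε f) {y : ℝ}
    (hy : 0 ≤ y) : Function.Periodic
      (fun w : ℝ => Complex.exp (shearIsotopy ε f w y * Complex.I)) (2 * Real.pi) := by
  intro w
  have hε : ε = 1 ∨ ε = -1 := mul_self_eq_one_iff.1 hf.sign_mul_self
  simp only [hf.shearIsotopy_add_two_pi hy]
  rw [Complex.exp_eq_exp_iff_exists_int]
  rcases hε with rfl | rfl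
  · exact ⟨1, by push_cast; ring⟩
  · exact ⟨-1, by push_cast; ring⟩

theorem IsSignedLift.isTwistMap_twistMap {ε : ℝ} {f : ℝ → ℝ} (hf : IsSignedLift ε f) :
    IsTwistMap (shearIsotopy ε f) (twistMap (shearIsotopy ε f)) := by
  intro r w hr hr1
  have hn : ‖(r : ℂ) * Complex.exp (w * Complex.I)‖ = r := by
    rw [norm_mul, Complex.norm_exp_ofReal_mul_I, mul_one, Complex.norm_real,
      Real.norm_of_nonneg hr]
  rw [twistMap, hn]
  rcases hr.eq_or_lt with rfl | hr0
  · simp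
  congr 1
  have h1 := Complex.norm_mul_exp_arg_mul_I ((r : ℂ) * Complex.exp (w * Complex.I))
  rw [hn] at h1
  have h2 := mul_left_cancel₀ (by exact_mod_cast hr0.ne') h1
  obtain ⟨n, hn⟩ := Complex.exp_eq_exp_iff_exists_int.1 h2
  have h3 : ((r : ℂ) * Complex.exp (w * Complex.I)).arg = w + n * (2 * Real.pi) := by
    have h4 := congrArg Complex.im hn
    simpa using h4
  rw [h3]
  exact (hf.periodic_exp_shearIsotopy (by linarith)).int_mul n w

namespace IsTwistMap

variable {F G : ℝ → ℝ → ℝ} {H K : ℂ → ℂ}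

theorem leftInvOn (hH : IsTwistMap F H) (hK : IsTwistMap G K)
    (hGF : ∀ w y, 0 ≤ y → G (F w y) y = w) : LeftInvOn K H closedDisk := by
  intro z hz
  rw [mem_closedBall_zero_iff] at hz
  rw [← Complex.norm_mul_exp_arg_mul_I z, hH _ _ (norm_nonneg z) hz, hK _ _ (norm_nonneg z) hz,
    hGF _ _ (by linarith)]

theorem mapsTo (hH : IsTwistMap F H) : MapsTo H closedDisk closedDisk := fun z hz => by
  rw [mem_closedBall_zero_iff] at hz ⊢
  rwa [hH.norm_apply hz]

/-- At the centre, preservation of the modulus suffices. Elsewhere the formula holds for every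
choice of angle, so a branch continuous at `z₀` can replace `arg`. -/
theorem continuousOn (hH : IsTwistMap F H)
    (hF : ContinuousOn (fun q : ℝ × ℝ => F q.1 q.2) (univ ×ˢ Icc 0 1)) :
    ContinuousOn H closedDisk := by
  intro z₀ hz₀
  rcases eq_or_ne z₀ 0 with rfl | h0
  · have h1 : H 0 = 0 := by rw [← norm_eq_zero, hH.norm_apply (by simp), norm_zero]
    rw [ContinuousWithinAt, h1, tendsto_zero_iff_norm_tendsto_zero]
    have h2 : Tendsto (fun z : ℂ => ‖z‖) (𝓝[closedDisk] 0) (𝓝 0) := by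
      simpa using (continuous_norm.tendsto (0 : ℂ)).mono_left nhdsWithin_le_nhds
    refine h2.congr' ?_
    filter_upwards [self_mem_nhdsWithin] with z hz
    exact (hH.norm_apply (mem_closedBall_zero_iff.1 hz)).symm
  · set θ : ℂ → ℝ := fun z => z₀.arg + (z / z₀).arg with hθ
    have hrep : ∀ z : ℂ, (‖z‖ : ℂ) * Complex.exp (θ z * Complex.I) = z := fun z => by
      have h1 := Complex.norm_mul_exp_arg_mul_I z₀
      have h2 := Complex.norm_mul_exp_arg_mul_I (z / z₀)
      have hn : (‖z₀‖ : ℂ) ≠ 0 := by simpa using h0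
      calc _ = (‖z₀‖ * Complex.exp (z₀.arg * Complex.I)) *
          (‖z / z₀‖ * Complex.exp ((z / z₀).arg * Complex.I)) := by
            simp only [hθ]
            rw [norm_div]
            push_cast
            rw [add_mul, Complex.exp_add]
            field_simp
        _ = z := by
            rw [h1, h2]
            field_simp
    have hθc : ContinuousAt θ z₀ := by
      refine continuousAt_const.add (ContinuousAt.comp (g := Complex.arg) ?_
        (continuousAt_id.div_const z₀))
      refine Complex.continuousAt_arg ?_
      simp [h0]
    have hFc : ContinuousWithinAt (fun z => F (θ z) (1 - ‖z‖)) closedDisk z₀ := by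
      have hmaps : MapsTo (fun z : ℂ => (θ z, 1 - ‖z‖)) closedDisk (univ ×ˢ Icc (0 : ℝ) 1) := by
        intro z hz
        rw [mem_closedBall_zero_iff] at hz
        exact ⟨mem_univ _, by simpa using hz, by simp⟩
      exact (hF _ (hmaps hz₀)).comp (f := fun z : ℂ => (θ z, 1 - ‖z‖))
        (hθc.prodMk (by fun_prop)).continuousWithinAt hmaps
    have hE : ContinuousWithinAt
        (fun z : ℂ => (‖z‖ : ℂ) * Complex.exp (F (θ z) (1 - ‖z‖) * Complex.I)) closedDisk z₀ := by
      have hexp : Continuous fun t : ℝ => Complex.exp (t * Complex.I) := by fun_prop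
      have hnorm : Continuous fun z : ℂ => (‖z‖ : ℂ) := by fun_prop
      exact hnorm.continuousWithinAt.mul (hexp.continuousAt.comp_continuousWithinAt hFc)
    have heq : ∀ z ∈ closedDisk,
        H z = (‖z‖ : ℂ) * Complex.exp (F (θ z) (1 - ‖z‖) * Complex.I) := fun z hz => by
      conv_lhs => rw [← hrep z]
      exact hH _ _ (norm_nonneg z) (mem_closedBall_zero_iff.1 hz)
    exact hE.congr heq (heq z₀ hz₀)

/-- Twist maps of mutually inverse angular isotopies are mutually inverse homeomorphisms. -/
def diskHomeomorph (hH : IsTwistMap F H) (hK : IsTwistMap G K)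
    (hF : ContinuousOn (fun q : ℝ × ℝ => F q.1 q.2) (univ ×ˢ Icc 0 1))
    (hG : ContinuousOn (fun q : ℝ × ℝ => G q.1 q.2) (univ ×ˢ Icc 0 1))
    (hGF : ∀ w y, 0 ≤ y → G (F w y) y = w) (hFG : ∀ w y, 0 ≤ y → F (G w y) y = w) :
    closedDisk ≃ₜ closedDisk where
  toFun := hH.mapsTo.restrict
  invFun := hK.mapsTo.restrict
  left_inv z := Subtype.ext (hH.leftInvOn hK hGF z.2)
  right_inv z := Subtype.ext (hK.leftInvOn hH hFG z.2)
  continuous_toFun := (hH.continuousOn hF).mapsToRestrict hH.mapsTo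
  continuous_invFun := (hK.continuousOn hG).mapsToRestrict hK.mapsTo

theorem diskMap_of_eqOn (hH : IsTwistMap F H) {h : closedDisk → closedDisk}
    (hh : ∀ z, (h z : ℂ) = H z) : IsTwistMap F (diskMap h) := by
  intro r w hr hr1
  have hmem : (r : ℂ) * Complex.exp (w * Complex.I) ∈ closedDisk := by
    rw [mem_closedBall_zero_iff, norm_mul, Complex.norm_exp_ofReal_mul_I, mul_one,
      Complex.norm_real, Real.norm_of_nonneg hr]
    exact hr1
  rw [← hH r w hr hr1]
  exact (diskMap_coe h ⟨_, hmem⟩).trans (hh _)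

end IsTwistMap

theorem injOn_diskMap {h : closedDisk → closedDisk} (hh : Function.Injective h) :
    InjOn (diskMap h) openDisk := by
  intro z hz z' hz' heq
  have hz1 := Metric.ball_subset_closedBall hz
  have hz1' := Metric.ball_subset_closedBall hz'
  have h1 := diskMap_coe h ⟨z, hz1⟩
  have h2 := diskMap_coe h ⟨z', hz1'⟩
  have h3 : h ⟨z, hz1⟩ = h ⟨z', hz1'⟩ := Subtype.ext (h1.symm.trans (heq.trans h2))
  exact congrArg Subtype.val (hh h3)

end

theorem mainTheorem4 (φ : Circle ≃ₜ Circle) :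
    ∃ h : closedDisk ≃ₜ closedDisk,
      (∀ ζ : Circle, diskMap h (ζ : ℂ) = (φ ζ : ℂ)) ∧
      ∀ p : ℝ, 1 ≤ p → p < 2 →
        MemSobolevOne openDisk (ENNReal.ofReal p) (diskMap h) ∧
        MemSobolevOne openDisk (ENNReal.ofReal p) (diskMap h.symm) := by
  obtain ⟨ε, f, g, hf, hg, hgf, hfg, hφ⟩ := exists_signed_lifts φ
  have hF := hf.isTwistMap_twistMap
  have hG := hg.isTwistMap_twistMap
  set h : closedDisk ≃ₜ closedDisk := hF.diskHomeomorph hG hf.continuousOn_shearIsotopy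
    hg.continuousOn_shearIsotopy (fun w y hy => hf.shearIsotopy_leftInverse hg hgf hy w)
    (fun w y hy => hg.shearIsotopy_leftInverse hf hfg hy w)
  have hD : IsTwistMap (shearIsotopy ε f) (diskMap h) := hF.diskMap_of_eqOn fun _ => rfl
  have hD' : IsTwistMap (shearIsotopy ε g) (diskMap h.symm) := hG.diskMap_of_eqOn fun _ => rfl
  obtain ⟨C, hC⟩ := hf.exists_isTwistProfile
  obtain ⟨C', hC'⟩ := hg.exists_isTwistProfile
  refine ⟨h, fun ζ => ?_, fun p hp hp2 => ⟨hD.memSobolevOne hC (injOn_diskMap h.injective) hp hp2,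
    hD'.memSobolevOne hC' (injOn_diskMap h.symm.injective) hp hp2⟩⟩
  -- On the unit circle the height `1 - r` is 0, where the isotopy is `f` itself.
  have h1 := hD 1 (Complex.arg ζ) zero_le_one le_rfl
  rw [sub_self, hf.shearIsotopy_zero, Complex.ofReal_one, one_mul, one_mul, ← Circle.coe_exp,
    ← Circle.coe_exp, hφ, Circle.exp_arg] at h1
  exact h1
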